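/- Theorem (strong Marstrand projection theorem). Let $1 \le m \le n-1$ be integers. Let $G_{n,m}$ be the Grassmannian of $m$-dimensional linear subspaces of $\mathbb{R}^n$, and let $\gamma_{n,m}$ be its orthogonally invariant Borel probability measure. For $V \in G_{n,m}$ let $\mathrm{proj}_V : \mathbb{R}^n \to V$ be the orthogonal projection and let $\mathcal{L}^m$ be the $m$-dimensional Lebesgue (outer) measure on $V$. Let $\mathcal{H}^s$ denote $s$-dimensional Hausdorff measure and $\dim_H$ Hausdorff dimension; a set is called $\mathcal{H}^s$-measurable if it is Carathéodory measurable for the outer measure $\mathcal{H}^s$. Let $E \subset \mathbb{R}^n$ be an $\mathcal{H}^s$-measurable set with $0 < \mathcal{H}^s(E) < \infty$, where $s = \dim_H E > 0$. Then there exists a set $X \subset G_{n,m}$ with $\gamma_{n,m}(X) = 0$ such that for all $V \in G_{n,m} \setminus X$ and all $\mathcal{H}^s$-measurable sets $F \subset E$ with $\mathcal{H}^s(F) > 0$: (i) $\dim_H \mathrm{proj}_V F = \min\{\dim_H F, m\}$; (ii) if $s > m$, then $\mathcal{L}^m(\mathrm{proj}_V F) > 0$. -/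

import Mathlib

open MeasureTheory Measure

noncomputable section

/-- Euclidean space `ℝⁿ`. -/
abbrev Euc (n : ℕ) : Type := EuclideanSpace ℝ (Fin n)

/-- The orthogonal group `O(n)`: the linear operators `g` of `ℝⁿ` with `gᵀ g = g gᵀ = 1`. It is a
topological group for the operator norm topology. -/
abbrev OrthGroup (n : ℕ) : Type := unitary (Euc n →L[ℝ] Euc n)

/-- The Grassmannian `G_{n,m}` of `m`-dimensional linear subspaces of `ℝⁿ`. -/
def Grassmann (n m : ℕ) : Type := {V : Submodule ℝ (Euc n) // Module.finrank ℝ V = m}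

instance (n : ℕ) : ContinuousStar (Euc n →L[ℝ] Euc n) :=
  ⟨(ContinuousLinearMap.adjoint (𝕜 := ℝ) (E := Euc n) (F := Euc n)).continuous⟩

namespace OrthGroup

instance (n : ℕ) : BorelSpace (OrthGroup n) :=
  inferInstanceAs (BorelSpace {g : Euc n →L[ℝ] Euc n // g ∈ unitary (Euc n →L[ℝ] Euc n)})

instance (n : ℕ) : CompactSpace (OrthGroup n) := by
  refine (isCompact_iff_compactSpace (X := Euc n →L[ℝ] Euc n)
    (s := (unitary (Euc n →L[ℝ] Euc n) : Set (Euc n →L[ℝ] Euc n)))).mp ?_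
  refine Metric.isCompact_of_isClosed_isBounded isClosed_unitary ?_
  refine (Metric.isBounded_closedBall (x := (0 : Euc n →L[ℝ] Euc n)) (r := 1)).subset ?_
  intro g hg
  rw [mem_closedBall_zero_iff]
  refine ContinuousLinearMap.opNorm_le_bound _ zero_le_one fun x => ?_
  rw [ContinuousLinearMap.norm_map_of_mem_unitary hg, one_mul]

/-- The Haar probability measure of `O(n)`. -/
def haar (n : ℕ) : Measure (OrthGroup n) := haarMeasure ⊤

instance (n : ℕ) : IsProbabilityMeasure (haar n) :=
  ⟨by simpa [haar] using haarMeasure_self (K₀ := (⊤ : TopologicalSpace.PositiveCompacts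
    (OrthGroup n)))⟩

instance (n : ℕ) : IsMulLeftInvariant (haar n) :=
  inferInstanceAs (IsMulLeftInvariant (haarMeasure ⊤))

end OrthGroup

namespace Grassmann

/-- The standard topology of `G_{n,m}`, that of the metric `d(V, W) = ‖proj_V - proj_W‖`
(operator norm of the difference of the orthogonal projections). -/
instance (n m : ℕ) : TopologicalSpace (Grassmann n m) :=
  TopologicalSpace.induced (fun V => V.1.starProjection) inferInstance

instance (n m : ℕ) : MeasurableSpace (Grassmann n m) := borel _

instance (n m : ℕ) : BorelSpace (Grassmann n m) := ⟨rfl⟩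

/-- The image `g V` of a subspace `V` under `g ∈ O(n)`. -/
def rotate {n m : ℕ} (g : OrthGroup n) (V : Grassmann n m) : Grassmann n m :=
  ⟨V.1.map (Unitary.linearIsometryEquiv g).toLinearEquiv.toLinearMap,
    ((Unitary.linearIsometryEquiv g).toLinearEquiv.finrank_map_eq V.1).trans V.2⟩

/-- The coordinate subspace spanned by the first `m` vectors of the standard basis. -/
def coord (n m : ℕ) (h : m ≤ n) : Grassmann n m :=
  ⟨Submodule.span ℝ (Set.range fun i : Fin m => EuclideanSpace.single (Fin.castLE h i) (1 : ℝ)), by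
    have hb := (EuclideanSpace.basisFun (Fin n) ℝ).orthonormal.linearIndependent.comp _
      (Fin.castLE_injective h)
    have hli : LinearIndependent ℝ
        (fun i : Fin m => EuclideanSpace.single (Fin.castLE h i) (1 : ℝ)) := by
      simpa [Function.comp_def] using hb
    rw [finrank_span_eq_card hli, Fintype.card_fin]⟩

/-- The measure `γ_{n,m}` on the Borel sets of `G_{n,m}`: the law of `g ↦ g V₀` for a Haar
distributed `g ∈ O(n)`, with `V₀` a coordinate subspace. It is the orthogonally invariant Borel
probability measure of `G_{n,m}`. -/
def γ (n m : ℕ) (h : m ≤ n) : Measure (Grassmann n m) :=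
  (OrthGroup.haar n).map fun g => rotate g (coord n m h)

lemma starProjection_rotate {n m : ℕ} (g : OrthGroup n) (V : Grassmann n m) :
    (rotate g V).1.starProjection =
      (g : Euc n →L[ℝ] Euc n) * V.1.starProjection * (star g : OrthGroup n) := by
  ext1 x
  exact Submodule.starProjection_map_apply (Unitary.linearIsometryEquiv g) V.1 x

lemma continuous_rotate {n m : ℕ} (V : Grassmann n m) :
    Continuous fun g : OrthGroup n => rotate g V := by
  rw [continuous_induced_rng]
  have : ((fun V : Grassmann n m => V.1.starProjection) ∘ fun g : OrthGroup n => rotate g V) =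
      fun g : OrthGroup n =>
        (g : Euc n →L[ℝ] Euc n) * V.1.starProjection * (star g : OrthGroup n) :=
    funext fun g => starProjection_rotate g V
  rw [this]
  fun_prop

lemma continuous_rotate_left {n m : ℕ} (g : OrthGroup n) :
    Continuous fun V : Grassmann n m => rotate g V := by
  rw [continuous_induced_rng]
  have : ((fun V : Grassmann n m => V.1.starProjection) ∘ fun V => rotate g V) =
      fun V : Grassmann n m =>
        (g : Euc n →L[ℝ] Euc n) * V.1.starProjection * (star g : OrthGroup n) :=
    funext fun V => starProjection_rotate g V
  rw [this]
  have h : Continuous fun V : Grassmann n m => V.1.starProjection := continuous_induced_dom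
  fun_prop

lemma rotate_mul {n m : ℕ} (g h : OrthGroup n) (V : Grassmann n m) :
    rotate (g * h) V = rotate g (rotate h V) := by
  apply Subtype.ext
  exact Submodule.map_comp (Unitary.linearIsometryEquiv h).toLinearEquiv.toLinearMap
    (Unitary.linearIsometryEquiv g).toLinearEquiv.toLinearMap V.1

instance (n m : ℕ) (h : m ≤ n) : IsProbabilityMeasure (γ n m h) :=
  isProbabilityMeasure_map (continuous_rotate _).measurable.aemeasurable

/-- `γ_{n,m}` is invariant under `O(n)`. -/
lemma map_rotate_γ {n m : ℕ} (h : m ≤ n) (g : OrthGroup n) :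
    (γ n m h).map (rotate g) = γ n m h := by
  have h1 := (continuous_rotate (coord n m h)).measurable
  have h2 := (continuous_rotate_left (m := m) g).measurable
  have h3 : (rotate g ∘ fun k => rotate k (coord n m h)) =
      (fun k => rotate k (coord n m h)) ∘ fun k => g * k :=
    funext fun k => (rotate_mul g k _).symm
  rw [γ, map_map h2 h1, h3, ← map_map h1 (measurable_const_mul g), map_mul_left_eq_self]

/-- Orthogonal projection of `ℝⁿ` onto the subspace `V`. -/
def proj {n m : ℕ} (V : Grassmann n m) : Euc n → V.1 := fun x => V.1.orthogonalProjectionOnto x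

/-- The `m`-dimensional Lebesgue measure of the `m`-dimensional subspace `V` of `ℝⁿ`, normalised
so that the cubes spanned by orthonormal bases of `V` have measure `1`. -/
def lebesgue {n m : ℕ} (V : Grassmann n m) : Measure V.1 :=
  volume

end Grassmann

/-- A set is `𝓗ˢ`-measurable if it is measurable in the sense of Carathéodory for the outer
measure `𝓗ˢ`. -/
def HausdorffMeasurable {n : ℕ} (s : ℝ) (A : Set (Euc n)) : Prop :=
  (μH[s] : Measure (Euc n)).toOuterMeasure.IsCaratheodory A

end

/-!
The proof is the potential-theoretic one, arranged so that the exceptional set of planes depends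
only on the measure `μ`, the restriction of `ℋˢ` to `E`.

By a covering argument, `μ` has finite upper `s`-density at almost every point
(`hausdorffMeasure_setOf_forall_exists_lt_measure_closedEBall`), hence finite potentials
`∫ |y - x|⁻ᵗ dμ(y)` for all `t < s` at almost every `x` (`ae_lintegral_edist_rpow_neg_lt_top`).
A random plane `V` satisfies `γ {V : |proj_V x| ≤ r} ≤ C (r / |x|)ᵐ`
(`gamma_setOf_enorm_starProjection_le`): this compares the direction of `g⁻¹ x`, for a Haar
distributed `g`, with a uniformly distributed point of the unit ball. Interpolating and integrating
in `y`, the `γ`-average of the mass that the projected measure gives to the ball of radius `r` around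
`proj_V x` is at most `C rᵗ ∫ |y - x|⁻ᵗ dμ(y)`, for `t ≤ m`.

Summing over dyadic radii, for almost every `V` the projected measure has growth exponent at least
`t` at `μ`-almost every point, for every rational `t < min s m`
(`Grassmann.ae_tsum_tubeMass_lt_top`). If `m < s`, Fatou's lemma with `t = m` shows that for almost
every `V` it has finite lower `m`-density at almost every point
(`Grassmann.ae_liminf_tubeMass_lt_top`). Fubini's theorem interchanges the two quantifiers.

Let `V` be such a plane and let `F ⊆ E` have positive measure. On a part of `F` of positive measure
these bounds are uniform, so the mass distribution principle bounds `dimH (proj_V F)` below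
(`Grassmann.ofReal_le_dimH_image_proj`), and differentiation of measures shows that the projection
has positive Lebesgue measure when `m < s` (`Grassmann.lebesgue_image_proj_ne_zero`). The upper
bound for the dimension holds because `proj_V` is Lipschitz into an `m`-dimensional space.
-/

open Metric Set Filter Topology ENNReal NNReal

/-! ### Upper density of a finite measure -/

/-- The upper `s`-density of a finite measure is finite outside an `ℋˢ`-null set. If `x` has infinite
density, then for each `k` it is the centre of a ball with `k rˢ < μ(B)`, whose radius tends to `0`
as `k` grows because `μ` is finite; the fivefold enlargements of a disjoint Vitali subfamily cover
all such `x`, with `∑ (10 r)ˢ ≤ 10ˢ μ(X) / k`. -/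
theorem hausdorffMeasure_setOf_forall_exists_lt_measure_closedEBall {X : Type*} [MetricSpace X]
    [SecondCountableTopology X] [MeasurableSpace X] [BorelSpace X] {s : ℝ} (hs : 0 < s)
    (μ : Measure X) [IsFiniteMeasure μ] :
    μH[s] {x | ∀ k : ℕ, ∃ r : ℝ≥0, 0 < r ∧ k * (r : ℝ≥0∞) ^ s < μ (closedEBall x r)} = 0 := by
  set A := {x | ∀ k : ℕ, ∃ r : ℝ≥0, 0 < r ∧ k * (r : ℝ≥0∞) ^ s < μ (closedEBall x r)} with hA
  set R : ℕ → ℝ≥0∞ := fun k => (μ univ * (k : ℝ≥0∞)⁻¹) ^ s⁻¹ with hRdef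
  have key : ∀ k : ℕ, ∃ u : Set (X × ℝ≥0), k ≠ 0 → u.Countable ∧
      (∀ p ∈ u, k * (p.2 : ℝ≥0∞) ^ s ≤ μ (closedEBall p.1 p.2) ∧ p.2 ≤ R k) ∧
      (u.PairwiseDisjoint fun p => closedEBall p.1 (p.2 : ℝ≥0∞)) ∧
      A ⊆ ⋃ p : u, closedEBall p.1.1 (5 * (p.1.2 : ℝ≥0∞)) := by
    intro k
    by_cases hk : k = 0
    · exact ⟨∅, fun h => absurd hk h⟩
    have hk0 : (k : ℝ≥0∞) ≠ 0 := by exact_mod_cast hk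
    let t : Set (X × ℝ≥0) := {p | 0 < p.2 ∧ k * (p.2 : ℝ≥0∞) ^ s < μ (closedEBall p.1 p.2)}
    have hR : ∀ p ∈ t, p.2 ≤ R k := by
      intro p hp
      rw [hRdef, ENNReal.le_rpow_inv_iff hs, ← div_eq_mul_inv,
        ENNReal.le_div_iff_mul_le (Or.inl hk0) (Or.inl (by simp)), mul_comm]
      exact hp.2.le.trans (measure_mono (subset_univ _))
    have hRtop : R k ≠ ∞ := ENNReal.rpow_ne_top_of_nonneg (by positivity)
      (ENNReal.mul_ne_top (measure_ne_top _ _) (ENNReal.inv_ne_top.2 hk0))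
    obtain ⟨u, hut, hdisj, hcov⟩ := Vitali.exists_disjoint_subfamily_covering_enlargement_closedBall
      t (fun p => p.1) (fun p => (p.2 : ℝ)) (R k).toReal
      (fun p hp => by simpa using (ENNReal.toReal_le_toReal (by simp) hRtop).2 (hR p hp))
      5 (by norm_num)
    refine ⟨u, fun _ => ⟨?_, fun p hp => ⟨(hut hp).2.le, hR p (hut hp)⟩, ?_, fun x hx => ?_⟩⟩
    · refine hdisj.countable_of_nonempty_interior fun p hp => ⟨p.1, ?_⟩
      exact ball_subset_interior_closedBall (mem_ball_self (hut hp).1)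
    · simpa only [closedEBall_coe] using hdisj
    · obtain ⟨r, hr, hlt⟩ := hx k
      obtain ⟨b, hb, hsub⟩ := hcov (x, r) ⟨hr, hlt⟩
      refine mem_iUnion.2 ⟨⟨b, hb⟩, ?_⟩
      have h5 : (5 * (b.2 : ℝ≥0∞)) = ((5 * b.2 : ℝ≥0) : ℝ≥0∞) := by norm_num
      rw [h5, closedEBall_coe]
      simpa using hsub (mem_closedBall_self r.2)
  choose u hu using key
  have hinv : Tendsto (fun k : ℕ => μ univ * (k : ℝ≥0∞)⁻¹) atTop (𝓝 0) := by
    simpa using ENNReal.Tendsto.const_mul ENNReal.tendsto_inv_nat_nhds_zero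
      (Or.inr (measure_ne_top μ univ))
  have hRlim : Tendsto (fun k => 10 * R k) atTop (𝓝 0) := by
    have := (ENNReal.continuous_rpow_const (y := s⁻¹)).tendsto 0 |>.comp hinv
    rw [ENNReal.zero_rpow_of_pos (by positivity)] at this
    simpa using ENNReal.Tendsto.const_mul this (Or.inr (by simp : (10 : ℝ≥0∞) ≠ ∞))
  have hdiam (k : ℕ) (p : u k) :
      ediam (closedEBall p.1.1 (5 * (p.1.2 : ℝ≥0∞))) ≤ 10 * (p.1.2 : ℝ≥0∞) := by
    refine ediam_closedEBall_le.trans (le_of_eq ?_)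
    rw [← mul_assoc]
    norm_num
  -- the index set is only known to be countable for `k ≠ 0`
  have hcount (k : ℕ) : Countable (u (k + 1)) := (hu (k + 1) (by simp)).1.to_subtype
  have hle := hausdorffMeasure_le_liminf_tsum s A (fun k => 10 * R (k + 1))
    (hRlim.comp (tendsto_add_atTop_nat 1))
    (fun k (p : u (k + 1)) => closedEBall p.1.1 (5 * (p.1.2 : ℝ≥0∞)))
    (Eventually.of_forall fun k p => (hdiam _ p).trans
      (mul_le_mul_right ((hu (k + 1) (by simp)).2.1 p p.2).2 _))
    (Eventually.of_forall fun k => (hu (k + 1) (by simp)).2.2.2)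
  have hsum (k : ℕ) : ∑' p : u (k + 1), ediam (closedEBall p.1.1 (5 * (p.1.2 : ℝ≥0∞))) ^ s ≤
      10 ^ s * (μ univ * ((k + 1 : ℕ) : ℝ≥0∞)⁻¹) := by
    obtain ⟨-, h1, h2, -⟩ := hu (k + 1) (by simp)
    have hk0 : ((k + 1 : ℕ) : ℝ≥0∞) ≠ 0 := by exact_mod_cast k.succ_ne_zero
    calc ∑' p : u (k + 1), ediam (closedEBall p.1.1 (5 * (p.1.2 : ℝ≥0∞))) ^ s
        ≤ ∑' p : u (k + 1), 10 ^ s * (μ (closedEBall p.1.1 p.1.2) * ((k + 1 : ℕ) : ℝ≥0∞)⁻¹) := by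
          refine ENNReal.tsum_le_tsum fun p => ?_
          refine (ENNReal.rpow_le_rpow (hdiam _ p) hs.le).trans ?_
          rw [ENNReal.mul_rpow_of_nonneg _ _ hs.le]
          gcongr
          rw [← div_eq_mul_inv, ENNReal.le_div_iff_mul_le (Or.inl hk0) (Or.inl (by simp)), mul_comm]
          exact (h1 p p.2).1
      _ = 10 ^ s * ((∑' p : u (k + 1), μ (closedEBall p.1.1 p.1.2)) * ((k + 1 : ℕ) : ℝ≥0∞)⁻¹) := by
          rw [ENNReal.tsum_mul_left, ENNReal.tsum_mul_right]
      _ ≤ _ := by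
          gcongr
          refine (tsum_meas_le_meas_iUnion_of_disjoint μ
            (fun p => isClosed_closedEBall.measurableSet) ?_).trans (measure_mono (subset_univ _))
          exact fun p q hpq => h2 p.2 q.2 (fun h => hpq (Subtype.ext h))
  have hlim : Tendsto (fun k : ℕ => 10 ^ s * (μ univ * ((k + 1 : ℕ) : ℝ≥0∞)⁻¹)) atTop (𝓝 0) := by
    simpa using ENNReal.Tendsto.const_mul (hinv.comp (tendsto_add_atTop_nat 1))
      (Or.inr (ENNReal.rpow_ne_top_of_nonneg hs.le (by simp : (10 : ℝ≥0∞) ≠ ∞)))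
  refine le_antisymm (hle.trans ?_) bot_le
  calc _ ≤ liminf (fun k : ℕ => 10 ^ s * (μ univ * ((k + 1 : ℕ) : ℝ≥0∞)⁻¹)) atTop :=
        liminf_le_liminf (Eventually.of_forall hsum)
    _ = 0 := hlim.liminf_eq

/-! ### Potentials and dyadic sums -/

theorem coe_two_inv_pow (j : ℕ) : (((2⁻¹ : ℝ≥0) ^ j : ℝ≥0) : ℝ≥0∞) = 2⁻¹ ^ j := by
  push_cast; rfl

theorem exists_two_inv_pow_near {d : ℝ≥0∞} (h0 : d ≠ 0) (h1 : d ≤ 1) :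
    ∃ j : ℕ, 2⁻¹ ^ (j + 1) < d ∧ d ≤ 2⁻¹ ^ j := by
  lift d to ℝ≥0 using ne_top_of_le_ne_top (by simp) h1
  obtain ⟨j, hj⟩ := exists_nat_pow_near_of_lt_one (x := (d : ℝ)) (y := 2⁻¹)
    (by simpa [pos_iff_ne_zero] using h0) (by exact_mod_cast h1) (by norm_num) (by norm_num)
  refine ⟨j, ?_, ?_⟩
  · rw [← coe_two_inv_pow, ENNReal.coe_lt_coe]
    exact_mod_cast hj.1
  · rw [← coe_two_inv_pow, ENNReal.coe_le_coe]
    exact_mod_cast hj.2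

/-- A dyadic majorant of the kernel `d ↦ d⁻ᵗ`. It holds at `d = 0` too, where both sides are `∞`. -/
theorem rpow_neg_le_tsum (d : ℝ≥0∞) {t : ℝ} (ht : 0 < t) :
    d ^ (-t) ≤ 1 + ∑' j : ℕ, 2 ^ t * (2 ^ t) ^ j * (Iic (2⁻¹ ^ j)).indicator 1 d := by
  rcases le_or_gt 1 d with h1 | h1
  · refine le_add_right ?_
    rw [ENNReal.rpow_neg, ENNReal.inv_le_one]
    exact ENNReal.one_le_rpow h1 ht
  refine le_add_left ?_
  by_cases h0 : d = 0
  · subst h0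
    have : ∑' j : ℕ, (2 : ℝ≥0∞) ^ t * (2 ^ t) ^ j * (Iic (2⁻¹ ^ j)).indicator 1 (0 : ℝ≥0∞) = ∞ := by
      refine top_le_iff.1 ?_
      calc ∞ = ∑' _ : ℕ, (1 : ℝ≥0∞) := (ENNReal.tsum_const_eq_top_of_ne_zero one_ne_zero).symm
        _ ≤ _ := ENNReal.tsum_le_tsum fun j => by
          have h2 : (1 : ℝ≥0∞) ≤ 2 ^ t := ENNReal.one_le_rpow (by norm_num) ht
          simpa using one_le_mul h2 (one_le_pow₀ h2)
    rw [this]; exact le_top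
  obtain ⟨j, hj1, hj2⟩ := exists_two_inv_pow_near h0 h1.le
  refine le_trans ?_ (ENNReal.le_tsum j)
  rw [indicator_of_mem (by exact hj2), Pi.one_apply, mul_one, ENNReal.rpow_neg,
    ← ENNReal.inv_rpow, ← pow_succ', ← ENNReal.rpow_natCast, ← ENNReal.rpow_mul, mul_comm t,
    ENNReal.rpow_mul, ENNReal.rpow_natCast]
  refine ENNReal.rpow_le_rpow ?_ ht.le
  rw [← ENNReal.inv_le_inv, inv_inv, ENNReal.inv_pow]
  exact hj1.le

theorem two_rpow_mul_inv_lt_one {s t : ℝ} (h : t < s) : (2 : ℝ≥0∞) ^ t * 2⁻¹ ^ s < 1 := by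
  rw [ENNReal.inv_rpow, ← ENNReal.rpow_neg, ← ENNReal.rpow_add _ _ (by simp) (by simp)]
  exact ENNReal.rpow_lt_one_of_one_lt_of_neg (by norm_num) (by linarith)

theorem inv_pow_rpow (j : ℕ) (t : ℝ) : ((2⁻¹ : ℝ≥0∞) ^ j) ^ t = (2⁻¹ ^ t) ^ j := by
  rw [← ENNReal.rpow_natCast, ← ENNReal.rpow_mul, mul_comm, ENNReal.rpow_mul, ENNReal.rpow_natCast]

/-- A measure satisfying `μ(B(x, r)) ≤ K rˢ` has finite `t`-potential at `x` for every `t < s`. -/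
theorem lintegral_edist_rpow_neg_lt_top {X : Type*} [PseudoEMetricSpace X] [MeasurableSpace X]
    [OpensMeasurableSpace X] (μ : Measure X) [IsFiniteMeasure μ] {s t : ℝ} (ht : 0 < t)
    (hts : t < s) {x : X} {K : ℝ≥0∞} (hK : K ≠ ∞)
    (h : ∀ r : ℝ≥0, 0 < r → μ (closedEBall x r) ≤ K * (r : ℝ≥0∞) ^ s) :
    ∫⁻ y, edist y x ^ (-t) ∂μ < ∞ := by
  have hind (j : ℕ) : (fun y => (Iic (2⁻¹ ^ j)).indicator (1 : ℝ≥0∞ → ℝ≥0∞) (edist y x)) =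
      (closedEBall x (2⁻¹ ^ j)).indicator 1 := by
    ext y; simp [indicator, mem_closedEBall]
  calc ∫⁻ y, edist y x ^ (-t) ∂μ
      ≤ ∫⁻ y, 1 + ∑' j : ℕ, 2 ^ t * (2 ^ t) ^ j * (Iic (2⁻¹ ^ j)).indicator 1 (edist y x) ∂μ :=
        lintegral_mono fun y => rpow_neg_le_tsum _ ht
    _ = μ univ + ∑' j : ℕ, 2 ^ t * (2 ^ t) ^ j * μ (closedEBall x (2⁻¹ ^ j)) := by
        rw [lintegral_add_left measurable_const, lintegral_const, one_mul, lintegral_tsum]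
        · congr 1
          refine tsum_congr fun j => ?_
          rw [lintegral_const_mul _ (by
            rw [hind]; exact measurable_one.indicator isClosed_closedEBall.measurableSet), hind,
            lintegral_indicator_one isClosed_closedEBall.measurableSet]
        · intro j
          refine Measurable.aemeasurable (Measurable.const_mul ?_ _)
          rw [hind]; exact measurable_one.indicator isClosed_closedEBall.measurableSet
    _ ≤ μ univ + ∑' j : ℕ, 2 ^ t * K * (2 ^ t * 2⁻¹ ^ s) ^ j := by
        refine add_le_add_right (ENNReal.tsum_le_tsum fun j => ?_) _
        have h1 := h (2⁻¹ ^ j) (by positivity)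
        rw [coe_two_inv_pow, inv_pow_rpow] at h1
        calc _ ≤ 2 ^ t * (2 ^ t) ^ j * (K * (2⁻¹ ^ s) ^ j) := by gcongr
          _ = _ := by rw [mul_pow]; ring
    _ < ∞ := by
        rw [ENNReal.tsum_mul_left, ENNReal.tsum_geometric]
        refine ENNReal.add_lt_top.2 ⟨measure_lt_top _ _, ENNReal.mul_lt_top ?_ ?_⟩
        · exact ENNReal.mul_lt_top (ENNReal.rpow_lt_top_of_nonneg ht.le (by simp)) hK.lt_top
        · rw [ENNReal.inv_lt_top, tsub_pos_iff_lt]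
          exact two_rpow_mul_inv_lt_one hts

/-! ### Lower bounds for Hausdorff and Lebesgue measure -/

/-- The mass distribution principle, with the growth condition asked only at dyadic radii and
only at the points of `T`. The set `T` need not be measurable: the comparison is made with the
outer measure `S ↦ ν (S ∩ T)`. -/
theorem hausdorffMeasure_ne_zero_of_measure_closedEBall_le {X : Type*} [MetricSpace X]
    [MeasurableSpace X] [BorelSpace X] (ν : Measure X) {t : ℝ} (ht : 0 < t) {T : Set X}
    {K : ℝ≥0∞} (hK : K ≠ ∞) (hT : ν T ≠ 0)
    (h : ∀ x ∈ T, ∀ j : ℕ, ν (closedEBall x (2⁻¹ ^ j)) ≤ K * (2⁻¹ ^ t) ^ j) :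
    μH[t] T ≠ 0 := by
  -- The factor `2 ^ t` is lost in rounding the diameter up to a dyadic radius; `K + 1` instead of `K`
  -- makes the constant nonzero, as `OuterMeasure.mkMetric_smul` requires.
  set c : ℝ≥0∞ := (K + 1) * 2 ^ t with hc
  have hc0 : c ≠ 0 := mul_ne_zero (by simp) (by simp [ENNReal.rpow_eq_zero_iff])
  have hctop : c ≠ ∞ := ENNReal.mul_ne_top (by simp [hK])
    (ENNReal.rpow_ne_top_of_nonneg ht.le (by simp))
  have hle : OuterMeasure.restrict T ν.toOuterMeasure ≤
      OuterMeasure.mkMetric (c • fun r : ℝ≥0∞ => r ^ t) := by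
    refine OuterMeasure.le_mkMetric _ _ 1 one_pos fun S hS => ?_
    rw [OuterMeasure.restrict_apply]
    change ν (S ∩ T) ≤ c * ediam S ^ t
    rcases (S ∩ T).eq_empty_or_nonempty with he | ⟨x, hxS, hxT⟩
    · simp [he]
    have hsub : S ∩ T ⊆ closedEBall x (ediam S) := fun y hy => edist_le_ediam_of_mem hy.1 hxS
    -- A set of diameter zero is handled by letting the radius tend to `0`: it is `ν`-null on `T`.
    by_cases h0 : ediam S = 0
    · have hj (j : ℕ) : ν (S ∩ T) ≤ K * (2⁻¹ ^ t) ^ j := by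
        refine (measure_mono (hsub.trans (closedEBall_subset_closedEBall ?_))).trans (h x hxT j)
        simp [h0]
      have hlim : Tendsto (fun j : ℕ => K * ((2⁻¹ : ℝ≥0∞) ^ t) ^ j) atTop (𝓝 0) := by
        have h1 : (2⁻¹ : ℝ≥0∞) ^ t < 1 := ENNReal.rpow_lt_one (by simp) ht
        simpa using ENNReal.Tendsto.const_mul
          (ENNReal.tendsto_pow_atTop_nhds_zero_of_lt_one h1) (Or.inr hK)
      exact (ge_of_tendsto' hlim hj).trans bot_le
    obtain ⟨j, hj1, hj2⟩ := exists_two_inv_pow_near h0 hS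
    calc ν (S ∩ T) ≤ K * (2⁻¹ ^ t) ^ j :=
          (measure_mono (hsub.trans (closedEBall_subset_closedEBall hj2))).trans (h x hxT j)
      _ ≤ (K + 1) * (2⁻¹ ^ t) ^ j := by gcongr; exact le_self_add
      _ = (K + 1) * 2 ^ t * (2⁻¹ ^ (j + 1)) ^ t := by
          rw [inv_pow_rpow, pow_succ', mul_assoc, ← mul_assoc (2 ^ t),
            ← ENNReal.mul_rpow_of_nonneg _ _ ht.le, ENNReal.mul_inv_cancel (by simp) (by simp),
            ENNReal.one_rpow, one_mul]
      _ ≤ c * ediam S ^ t := by gcongr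
  intro h0
  refine hT ?_
  have h1 := hle T
  rw [OuterMeasure.restrict_apply, inter_self, OuterMeasure.mkMetric_smul _ hctop hc0,
    ← mkMetric_toOuterMeasure] at h1
  change ν T ≤ c * μH[t] T at h1
  simpa [h0] using h1

/-- A finite measure charges no Lebesgue null set on which its lower density is bounded. This is the
comparison of two measures along the Besicovitch Vitali family of `ν`, so `T` is arbitrary. -/
theorem measure_eq_zero_of_frequently_measure_closedBall_le {V : Type*} [NormedAddCommGroup V]
    [NormedSpace ℝ V] [FiniteDimensional ℝ V] [MeasurableSpace V] [BorelSpace V] (vol : Measure V)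
    [IsAddHaarMeasure vol] (ν : Measure V) [IsFiniteMeasure ν] {T : Set V} {K : ℝ≥0∞}
    (hK : K ≠ ∞)
    (h : ∀ x ∈ T, ∃ᶠ j : ℕ in atTop, ν (closedEBall x (2⁻¹ ^ j)) ≤
      K * (2⁻¹ ^ Module.finrank ℝ V) ^ j) (hT : vol T = 0) : ν T = 0 := by
  set c := vol (ball 0 1)
  have hc0 : c ≠ 0 := (measure_ball_pos _ _ one_pos).ne'
  have hctop : c ≠ ∞ := measure_ball_lt_top.ne
  have hKc : K / c ≠ ∞ := ENNReal.div_ne_top hK hc0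
  lift K / c to ℝ≥0 using hKc with L hL
  have hν : ν T ≤ (L • vol) T := by
    refine (Besicovitch.vitaliFamily ν).measure_le_of_frequently_le (L • vol) AbsolutelyContinuous.rfl T
      fun x hx => ?_
    have hpow : Tendsto (fun j : ℕ => ((2⁻¹ : ℝ≥0) ^ j : ℝ)) atTop (𝓝[>] 0) :=
      tendsto_pow_atTop_nhdsWithin_zero_of_lt_one (by norm_num) (by norm_num)
    refine (((Besicovitch.tendsto_filterAt ν x).comp hpow).frequently ((h x hx).mono ?_))
    intro j hj
    rw [← coe_two_inv_pow, closedEBall_coe] at hj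
    refine hj.trans (le_of_eq ?_)
    change _ = (L : ℝ≥0∞) * vol _
    rw [Function.comp_apply, addHaar_closedBall _ _ (by positivity), hL, mul_comm _ (vol _),
      ← mul_assoc, ENNReal.div_mul_cancel hc0 hctop, ← pow_mul, mul_comm _ j, pow_mul,
      ENNReal.ofReal_pow (by positivity), ENNReal.ofReal_pow (by positivity)]
    simp
  simpa [hT] using hν

/-! ### Planes nearly orthogonal to a given vector -/

instance (n m : ℕ) : SecondCountableTopology (Grassmann n m) :=
  TopologicalSpace.secondCountableTopology_induced _ _ _

theorem exists_orthGroup_apply_eq {n : ℕ} {x y : Euc n} (h : ‖x‖ = ‖y‖) :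
    ∃ g : OrthGroup n, Unitary.linearIsometryEquiv g x = y :=
  ⟨Unitary.linearIsometryEquiv.symm (ℝ ∙ (x - y))ᗮ.reflection, by
    rw [MulEquiv.apply_symm_apply]; exact Submodule.reflection_sub h⟩

theorem continuous_uncurry_linearIsometryEquiv_symm (n : ℕ) :
    Continuous fun p : OrthGroup n × Euc n => (Unitary.linearIsometryEquiv p.1).symm p.2 := by
  have : (fun p : OrthGroup n × Euc n => (Unitary.linearIsometryEquiv p.1).symm p.2) =
      fun p => ((star p.1 : OrthGroup n) : Euc n →L[ℝ] Euc n) p.2 := rfl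
  rw [this]
  fun_prop

/-- The law of `g⁻¹ x`, for a fixed vector `x`, gives a cone `S` at most the mass that the normalised
Lebesgue measure of the unit ball does. The mass does not depend on `x ≠ 0`, since it is invariant under
dilations and `O(n)` is transitive on spheres; averaging it over the unit ball and exchanging the
integrals gives the volume of the part of `S` in the ball. -/
theorem haar_setOf_symm_apply_mem_mul_le {n : ℕ} {S : Set (Euc n)} (hS : MeasurableSet S)
    (h0 : (0 : Euc n) ∈ S) (hsmul : ∀ c : ℝ, 0 < c → ∀ x, c • x ∈ S ↔ x ∈ S) {x : Euc n}
    (hx : x ≠ 0) :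
    OrthGroup.haar n {g | (Unitary.linearIsometryEquiv g).symm x ∈ S} *
      volume (ball (0 : Euc n) 1) ≤ volume (ball 0 1 ∩ S) := by
  set f : Euc n → ℝ≥0∞ :=
    fun x => OrthGroup.haar n {g | (Unitary.linearIsometryEquiv g).symm x ∈ S} with hf
  have hrot (h : OrthGroup n) (y : Euc n) : f (Unitary.linearIsometryEquiv h y) = f y := by
    have : {g : OrthGroup n | (Unitary.linearIsometryEquiv g).symm
        (Unitary.linearIsometryEquiv h y) ∈ S} =
        (fun g => h⁻¹ * g) ⁻¹' {g | (Unitary.linearIsometryEquiv g).symm y ∈ S} := by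
      ext g
      simp only [mem_ofPred_eq, mem_preimage]
      have : (Unitary.linearIsometryEquiv (h⁻¹ * g)).symm y =
          (Unitary.linearIsometryEquiv g).symm (Unitary.linearIsometryEquiv h y) := by
        rw [LinearIsometryEquiv.symm_apply_eq, map_mul, LinearIsometryEquiv.coe_mul,
          Function.comp_apply, LinearIsometryEquiv.apply_symm_apply, map_inv]
        exact ((Unitary.linearIsometryEquiv h).symm_apply_apply y).symm
      rw [this]
    rw [hf]
    simp only [this, measure_preimage_mul]
  have hle (y : Euc n) : f x ≤ f y := by
    by_cases hy : y = 0
    · subst hy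
      rw [hf]
      simpa [h0] using prob_le_one
    · have hxn := norm_pos_iff.2 hx
      have hyn := norm_pos_iff.2 hy
      obtain ⟨g, hg⟩ := exists_orthGroup_apply_eq (x := (‖y‖ / ‖x‖) • x) (y := y) (by
        rw [norm_smul, norm_div, norm_norm, norm_norm, div_mul_cancel₀ _ hxn.ne'])
      have : f ((‖y‖ / ‖x‖) • x) = f x := by
        rw [hf]
        simp only [map_smul, hsmul _ (div_pos hyn hxn)]
      rw [← hg, hrot, this]
  have hmeas : MeasurableSet {p : OrthGroup n × Euc n |
      (Unitary.linearIsometryEquiv p.1).symm p.2 ∈ S} :=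
    (continuous_uncurry_linearIsometryEquiv_symm n).measurable hS
  calc f x * volume (ball (0 : Euc n) 1) = ∫⁻ _ in ball (0 : Euc n) 1, f x := by
        rw [lintegral_const, restrict_apply_univ]
    _ ≤ ∫⁻ y in ball (0 : Euc n) 1, f y := lintegral_mono hle
    _ = ((OrthGroup.haar n).prod (volume.restrict (ball (0 : Euc n) 1)))
          {p | (Unitary.linearIsometryEquiv p.1).symm p.2 ∈ S} := (prod_apply_symm hmeas).symm
    _ = ∫⁻ g, volume.restrict (ball (0 : Euc n) 1)
          {y | (Unitary.linearIsometryEquiv g).symm y ∈ S} ∂(OrthGroup.haar n) :=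
        prod_apply hmeas
    _ = ∫⁻ g, volume (ball (0 : Euc n) 1 ∩ S) ∂(OrthGroup.haar n) := by
        refine lintegral_congr fun g => ?_
        have hmp := (Unitary.linearIsometryEquiv g).symm.measurePreserving
        rw [← hmp.measure_preimage (measurableSet_ball.inter hS).nullMeasurableSet,
          restrict_apply' measurableSet_ball]
        congr 1
        ext y
        simp [and_comm]
    _ = volume (ball 0 1 ∩ S) := by simp

theorem volume_setOf_forall_norm_le {n m : ℕ} (h : m ≤ n) {δ : ℝ} :
    volume {x : Euc n | ‖x‖ ≤ 1 ∧ ∀ i : Fin m, ‖x (Fin.castLE h i)‖ ≤ δ} ≤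
      2 ^ n * ENNReal.ofReal δ ^ m := by
  set a : Fin n → ℝ := fun i => if (i : ℕ) < m then δ else 1 with ha
  have hsub : {x : Euc n | ‖x‖ ≤ 1 ∧ ∀ i : Fin m, ‖x (Fin.castLE h i)‖ ≤ δ} ⊆
      (MeasurableEquiv.toLp 2 (Fin n → ℝ)).symm ⁻¹' (univ.pi fun i => Icc (-a i) (a i)) := by
    rintro x ⟨hx1, hx2⟩ i -
    change x i ∈ Icc (-a i) (a i)
    rw [mem_Icc, ← abs_le, ← Real.norm_eq_abs]
    by_cases hi : (i : ℕ) < m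
    · simpa [ha, hi] using hx2 ⟨i, hi⟩
    · simpa [ha, hi] using (PiLp.norm_apply_le x i).trans hx1
  refine (measure_mono hsub).trans (le_of_eq ?_)
  rw [(EuclideanSpace.volume_preserving_symm_measurableEquiv_toLp (Fin n)).measure_preimage
    (MeasurableSet.univ_pi fun i => measurableSet_Icc).nullMeasurableSet, volume_pi_pi]
  have hprod (i : Fin n) : volume (Icc (-a i) (a i)) =
      2 * if (i : ℕ) < m then ENNReal.ofReal δ else 1 := by
    rw [Real.volume_Icc, show a i - -a i = 2 * a i by ring, ENNReal.ofReal_mul (by norm_num)]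
    by_cases hi : (i : ℕ) < m <;> simp [ha, hi]
  simp only [hprod, Finset.prod_mul_distrib, Finset.prod_const, Finset.card_univ, Fintype.card_fin]
  congr 1
  rw [Finset.prod_ite, Finset.prod_const, Finset.prod_const_one, mul_one]
  congr 1
  rw [Fin.card_filter_val_lt]
  omega

theorem norm_apply_le_norm_starProjection_coord {n m : ℕ} (h : m ≤ n) (x : Euc n) (i : Fin m) :
    ‖x (Fin.castLE h i)‖ ≤ ‖(Grassmann.coord n m h).1.starProjection x‖ := by
  set P := (Grassmann.coord n m h).1.starProjection
  set e : Euc n := EuclideanSpace.single (Fin.castLE h i) (1 : ℝ)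
  have he : e ∈ (Grassmann.coord n m h).1 := Submodule.subset_span ⟨i, rfl⟩
  have h1 : x (Fin.castLE h i) = inner ℝ e (P x) := by
    rw [← Submodule.inner_starProjection_left_eq_right, Submodule.starProjection_eq_self_iff.2 he]
    simp [e, EuclideanSpace.inner_single_left]
  rw [h1]
  refine (norm_inner_le_norm _ _).trans (le_of_eq ?_)
  simp [e]

/-- The geometric heart of the proof: `γ {V : |proj_V x| ≤ r} ≤ C (r / |x|)ᵐ`, stated without
division. The directions that `V₀` nearly annihilates form a cone, which inside the unit ball is
contained in a box with `m` short sides. -/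
theorem gamma_setOf_enorm_starProjection_le (n m : ℕ) (h : m ≤ n) :
    ∃ C : ℝ≥0∞, C ≠ ∞ ∧ ∀ (x : Euc n) (r : ℝ≥0),
      Grassmann.γ n m h {V | ‖V.1.starProjection x‖ₑ ≤ r} * ‖x‖ₑ ^ m ≤ C * (r : ℝ≥0∞) ^ m := by
  set c := volume (ball (0 : Euc n) 1)
  have hc0 : c ≠ 0 := (measure_ball_pos _ _ one_pos).ne'
  have hctop : c ≠ ∞ := measure_ball_lt_top.ne
  refine ⟨2 ^ n / c + 1, by finiteness, fun x r => ?_⟩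
  rcases eq_or_ne x 0 with rfl | hx
  · rcases eq_or_ne m 0 with rfl | hm
    · simp
    · simp [hm]
  have hxn := norm_pos_iff.2 hx
  set δ : ℝ := r / ‖x‖ with hδ
  set P := (Grassmann.coord n m h).1.starProjection with hP
  set S : Set (Euc n) := {y | ‖P y‖ ≤ δ * ‖y‖} with hS
  have hSm : MeasurableSet S := (isClosed_le (by fun_prop) (by fun_prop)).measurableSet
  have hcont : Continuous fun V : Grassmann n m => V.1.starProjection := continuous_induced_dom
  have hγ : Grassmann.γ n m h {V | ‖V.1.starProjection x‖ₑ ≤ r} =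
      OrthGroup.haar n {g | (Unitary.linearIsometryEquiv g).symm x ∈ S} := by
    rw [Grassmann.γ, map_apply (Grassmann.continuous_rotate _).measurable
      (isClosed_le (by fun_prop) (by fun_prop)).measurableSet]
    congr 1
    ext g
    have : (Grassmann.rotate g (Grassmann.coord n m h)).1.starProjection x =
        Unitary.linearIsometryEquiv g (P ((Unitary.linearIsometryEquiv g).symm x)) :=
      Submodule.starProjection_map_apply (Unitary.linearIsometryEquiv g) _ x
    simp only [mem_preimage, mem_ofPred_eq, this, hS, LinearIsometryEquiv.norm_map, hδ]
    rw [div_mul_cancel₀ _ hxn.ne', enorm_le_coe, ← NNReal.coe_le_coe, coe_nnnorm,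
      LinearIsometryEquiv.norm_map]
  have hle := haar_setOf_symm_apply_mem_mul_le hSm (by simp [hS])
    (fun c hc y => by
      simp only [hS, mem_ofPred_eq, map_smul, norm_smul, Real.norm_of_nonneg hc.le]
      rw [mul_left_comm, mul_le_mul_iff_right₀ hc]) hx
  have hbox : volume (ball 0 1 ∩ S) ≤ 2 ^ n * ENNReal.ofReal δ ^ m := by
    refine (measure_mono ?_).trans (volume_setOf_forall_norm_le h)
    rintro y ⟨hy1, hy2⟩
    have hy1 : ‖y‖ ≤ 1 := by simpa using (mem_ball_zero_iff.1 hy1).le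
    refine ⟨hy1, fun i => (norm_apply_le_norm_starProjection_coord h y i).trans (hy2.trans ?_)⟩
    exact mul_le_of_le_one_right (by positivity) hy1
  rw [hγ]
  have h1 : OrthGroup.haar n {g | (Unitary.linearIsometryEquiv g).symm x ∈ S} ≤
      2 ^ n / c * ENNReal.ofReal δ ^ m := by
    rw [show 2 ^ n / c * ENNReal.ofReal δ ^ m = 2 ^ n * ENNReal.ofReal δ ^ m / c by
      rw [div_eq_mul_inv, div_eq_mul_inv]; ring, ENNReal.le_div_iff_mul_le (Or.inl hc0)
      (Or.inl hctop)]
    exact hle.trans hbox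
  calc _ ≤ 2 ^ n / c * ENNReal.ofReal δ ^ m * ‖x‖ₑ ^ m := by gcongr
    _ = 2 ^ n / c * (r : ℝ≥0∞) ^ m := by
        rw [mul_assoc, ← mul_pow, ← ofReal_norm, ← ENNReal.ofReal_mul (by positivity), hδ,
          div_mul_cancel₀ _ hxn.ne', ENNReal.ofReal_coe_nnreal]
    _ ≤ _ := by gcongr; exact le_self_add

/-- Interpolation of the bound `C (r / |x|)ᵐ` with the trivial bound `1`. For `x = 0` the right-hand
side is `∞`, which is why `r ≠ 0` is needed. -/
theorem gamma_setOf_enorm_starProjection_le_rpow {n m : ℕ} (hm : 1 ≤ m) (h : m ≤ n) :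
    ∃ C : ℝ≥0∞, C ≠ ∞ ∧ ∀ t : ℝ, 0 < t → t ≤ m → ∀ (x : Euc n) (r : ℝ≥0), r ≠ 0 →
      Grassmann.γ n m h {V | ‖V.1.starProjection x‖ₑ ≤ r} ≤
        C * (r : ℝ≥0∞) ^ t * ‖x‖ₑ ^ (-t) := by
  obtain ⟨C, hC, hle⟩ := gamma_setOf_enorm_starProjection_le n m h
  refine ⟨C + 1, by finiteness, fun t ht htm x r hr => ?_⟩
  have hr' : (r : ℝ≥0∞) ≠ 0 := by exact_mod_cast hr
  have hm0 : (0 : ℝ) < m := by exact_mod_cast hm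
  set p := Grassmann.γ n m h {V | ‖V.1.starProjection x‖ₑ ≤ r} with hp
  rcases eq_or_ne x 0 with rfl | hx
  · have : (‖(0 : Euc n)‖ₑ : ℝ≥0∞) ^ (-t) = ∞ := by
      rw [enorm_zero, ENNReal.zero_rpow_of_neg (by linarith)]
    rw [this, ENNReal.mul_top (mul_ne_zero (by simp) (by simp [ENNReal.rpow_eq_zero_iff, hr']))]
    exact le_top
  have hx0 : ‖x‖ₑ ≠ 0 := by simpa using hx
  rw [ENNReal.rpow_neg, ← div_eq_mul_inv, ENNReal.le_div_iff_mul_le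
    (Or.inl (by simp [ENNReal.rpow_eq_zero_iff, hx0]))
    (Or.inl (ENNReal.rpow_ne_top_of_nonneg ht.le enorm_ne_top))]
  have hq0 : 0 ≤ t / m := by positivity
  have hq1 : t / m ≤ 1 := (div_le_one hm0).2 htm
  have hpow (a : ℝ≥0∞) : (a ^ m) ^ (t / m) = a ^ t := by
    rw [← ENNReal.rpow_natCast, ← ENNReal.rpow_mul, mul_div_cancel₀ _ hm0.ne']
  have h1 := ENNReal.rpow_le_rpow (hle x r) hq0
  rw [ENNReal.mul_rpow_of_nonneg _ _ hq0, ENNReal.mul_rpow_of_nonneg _ _ hq0, hpow, hpow] at h1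
  calc p * ‖x‖ₑ ^ t ≤ p ^ (t / m) * ‖x‖ₑ ^ t := by
        gcongr
        have := ENNReal.rpow_le_rpow_of_exponent_ge (prob_le_one : p ≤ 1) hq1
        rwa [ENNReal.rpow_one] at this
    _ ≤ C ^ (t / m) * (r : ℝ≥0∞) ^ t := h1
    _ ≤ (C + 1) * (r : ℝ≥0∞) ^ t := by
        gcongr
        calc C ^ (t / m) ≤ (C + 1) ^ (t / m) := by gcongr; exact le_self_add
          _ ≤ (C + 1) ^ (1 : ℝ) := ENNReal.rpow_le_rpow_of_exponent_le le_add_self hq1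
          _ = _ := ENNReal.rpow_one _

/-! ### Tubes around the fibres of a projection -/

/-- A function that is finite almost everywhere is bounded on a part of positive measure of any set of
positive outer measure; no measurability is needed. -/
theorem exists_nat_measure_inter_setOf_lt_ne_zero {α : Type*} [MeasurableSpace α] {μ : Measure α}
    {f : α → ℝ≥0∞} (hf : ∀ᵐ x ∂μ, f x < ∞) {F : Set α} (hF : μ F ≠ 0) :
    ∃ k : ℕ, μ (F ∩ {x | f x < k}) ≠ 0 := by
  by_contra! hcon
  refine hF (measure_mono_null ?_ (measure_union_null (measure_iUnion_null hcon) hf))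
  intro x hx
  by_cases hfx : f x < ∞
  · obtain ⟨k, hk⟩ := ENNReal.exists_nat_gt hfx.ne
    exact Or.inl (mem_iUnion.2 ⟨k, hx, hk⟩)
  · exact Or.inr hfx

namespace Grassmann

variable {n m : ℕ}

/-- The `μ`-mass of the tube of radius `2⁻ʲ` around the fibre of `proj_V` through `x`. It is the mass
that the image of `μ` under `proj_V` gives to the ball of radius `2⁻ʲ` around `proj_V x`. -/
def tubeMass (μ : Measure (Euc n)) (j : ℕ) (V : Grassmann n m) (x : Euc n) : ℝ≥0∞ :=
  μ {y | ‖V.1.starProjection (y - x)‖ₑ ≤ 2⁻¹ ^ j}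

theorem measurableSet_setOf_enorm_starProjection_sub_le (r : ℝ≥0∞) :
    MeasurableSet {p : (Grassmann n m × Euc n) × Euc n |
      ‖p.1.1.1.starProjection (p.2 - p.1.2)‖ₑ ≤ r} := by
  have hcont : Continuous fun V : Grassmann n m => V.1.starProjection := continuous_induced_dom
  have h1 : Continuous fun p : (Grassmann n m × Euc n) × Euc n =>
      p.1.1.1.starProjection (p.2 - p.1.2) :=
    (hcont.comp (continuous_fst.comp continuous_fst)).clm_apply
      (continuous_snd.sub (continuous_snd.comp continuous_fst))
  exact (isClosed_le h1.enorm continuous_const).measurableSet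

theorem measurable_tubeMass (μ : Measure (Euc n)) [SFinite μ] (j : ℕ) :
    Measurable fun p : Grassmann n m × Euc n => tubeMass μ j p.1 p.2 :=
  measurable_measure_prodMk_left (measurableSet_setOf_enorm_starProjection_sub_le (2⁻¹ ^ j))

theorem measurable_tubeMass_left (μ : Measure (Euc n)) [SFinite μ] (j : ℕ) (x : Euc n) :
    Measurable fun V : Grassmann n m => tubeMass μ j V x :=
  Measurable.of_uncurry_right (f := fun V x => tubeMass μ j V x) (measurable_tubeMass μ j)

/-- On average over `V`, the tubes around the fibres through `x` are no heavier than the `t`-potential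
of `μ` at `x` allows. -/
theorem exists_lintegral_tubeMass_le (hm : 1 ≤ m) (h : m ≤ n) (μ : Measure (Euc n)) [SFinite μ] :
    ∃ C : ℝ≥0∞, C ≠ ∞ ∧ ∀ t : ℝ, 0 < t → t ≤ m → ∀ (x : Euc n) (j : ℕ),
      ∫⁻ V, tubeMass μ j V x ∂(γ n m h) ≤
        C * (2⁻¹ ^ t) ^ j * ∫⁻ y, edist y x ^ (-t) ∂μ := by
  obtain ⟨C, hC, hle⟩ := gamma_setOf_enorm_starProjection_le_rpow hm h
  refine ⟨C, hC, fun t ht htm x j => ?_⟩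
  have hmeas : MeasurableSet {p : Grassmann n m × Euc n |
      ‖p.1.1.starProjection (p.2 - x)‖ₑ ≤ 2⁻¹ ^ j} := by
    have hf : Measurable fun p : Grassmann n m × Euc n => ((p.1, x), p.2) :=
      (measurable_fst.prodMk measurable_const).prodMk measurable_snd
    exact hf (measurableSet_setOf_enorm_starProjection_sub_le (2⁻¹ ^ j))
  calc ∫⁻ V, tubeMass μ j V x ∂(γ n m h) = ((γ n m h).prod μ)
        {p | ‖p.1.1.starProjection (p.2 - x)‖ₑ ≤ 2⁻¹ ^ j} := (prod_apply hmeas).symm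
    _ = ∫⁻ y, γ n m h {V | ‖V.1.starProjection (y - x)‖ₑ ≤ 2⁻¹ ^ j} ∂μ := prod_apply_symm hmeas
    _ ≤ ∫⁻ y, C * (2⁻¹ ^ t) ^ j * edist y x ^ (-t) ∂μ := by
        refine lintegral_mono fun y => ?_
        have := hle t ht htm (y - x) (2⁻¹ ^ j) (by positivity)
        rwa [coe_two_inv_pow, inv_pow_rpow, ← edist_eq_enorm_sub] at this
    _ = _ := by rw [lintegral_const_mul _ (by fun_prop)]

theorem ae_tsum_tubeMass_lt_top (hm : 1 ≤ m) (h : m ≤ n) (μ : Measure (Euc n)) [SFinite μ]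
    {t t' : ℝ} (htt' : t < t') (ht' : 0 < t') (htm : t' ≤ m) {x : Euc n}
    (hx : ∫⁻ y, edist y x ^ (-t') ∂μ < ∞) :
    ∀ᵐ V ∂(γ n m h), ∑' j, (2 ^ t) ^ j * tubeMass μ j V x < ∞ := by
  obtain ⟨C, hC, hle⟩ := exists_lintegral_tubeMass_le hm h μ
  have hmeas (j : ℕ) := measurable_tubeMass_left (m := m) μ j x
  refine ae_lt_top (Measurable.tsum fun j => (hmeas j).const_mul _) (ne_of_lt ?_)
  rw [lintegral_tsum fun j => ((hmeas j).const_mul _).aemeasurable]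
  calc ∑' j, ∫⁻ V, (2 ^ t) ^ j * tubeMass μ j V x ∂(γ n m h)
      ≤ ∑' j : ℕ, C * (∫⁻ y, edist y x ^ (-t') ∂μ) * (2 ^ t * 2⁻¹ ^ t') ^ j := by
        refine ENNReal.tsum_le_tsum fun j => ?_
        rw [lintegral_const_mul _ (hmeas j)]
        calc _ ≤ (2 ^ t) ^ j * (C * (2⁻¹ ^ t') ^ j * ∫⁻ y, edist y x ^ (-t') ∂μ) :=
              mul_le_mul_right (hle t' ht' htm x j) _
          _ = _ := by rw [mul_pow]; ring
    _ < ∞ := by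
        rw [ENNReal.tsum_mul_left, ENNReal.tsum_geometric]
        refine ENNReal.mul_lt_top (ENNReal.mul_lt_top hC.lt_top hx) ?_
        rw [ENNReal.inv_lt_top, tsub_pos_iff_lt]
        exact two_rpow_mul_inv_lt_one htt'

theorem ae_liminf_tubeMass_lt_top (hm : 1 ≤ m) (h : m ≤ n) (μ : Measure (Euc n)) [SFinite μ]
    {x : Euc n} (hx : ∫⁻ y, edist y x ^ (-(m : ℝ)) ∂μ < ∞) :
    ∀ᵐ V ∂(γ n m h), liminf (fun j => (2 ^ m) ^ j * tubeMass μ j V x) atTop < ∞ := by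
  obtain ⟨C, hC, hle⟩ := exists_lintegral_tubeMass_le hm h μ
  have hmeas (j : ℕ) : Measurable fun V : Grassmann n m => (2 ^ m) ^ j * tubeMass μ j V x :=
    (measurable_tubeMass_left μ j x).const_mul _
  refine ae_lt_top (Measurable.liminf hmeas) (ne_of_lt ?_)
  refine (lintegral_liminf_le hmeas).trans_lt ?_
  refine lt_of_le_of_lt (b := C * ∫⁻ y, edist y x ^ (-(m : ℝ)) ∂μ) ?_
    (ENNReal.mul_lt_top hC.lt_top hx)
  refine liminf_le_of_le (by isBoundedDefault) fun b hb => ?_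
  obtain ⟨j, hj⟩ := hb.exists
  refine hj.trans ?_
  rw [lintegral_const_mul' _ _ (by finiteness)]
  calc _ ≤ (2 ^ m) ^ j * (C * (2⁻¹ ^ (m : ℝ)) ^ j * ∫⁻ y, edist y x ^ (-(m : ℝ)) ∂μ) :=
        mul_le_mul_right (hle m (by exact_mod_cast hm) le_rfl x j) _
    _ = (2 ^ m * 2⁻¹ ^ m) ^ j * (C * ∫⁻ y, edist y x ^ (-(m : ℝ)) ∂μ) := by
        rw [ENNReal.rpow_natCast, mul_pow]; ring
    _ ≤ _ := by
        rw [← mul_pow, ENNReal.mul_inv_cancel (by simp) (by simp), one_pow, one_pow, one_mul]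

theorem tubeMass_eq_map_proj (μ : Measure (Euc n)) (j : ℕ) (V : Grassmann n m) (x : Euc n) :
    tubeMass μ j V x = μ.map V.proj (closedEBall (V.proj x) (2⁻¹ ^ j)) := by
  have hm : Measurable V.proj := V.1.orthogonalProjectionOnto.continuous.measurable
  rw [map_apply hm isClosed_closedEBall.measurableSet]
  refine congrArg μ (Set.ext fun y => ?_)
  rw [mem_preimage, mem_closedEBall, edist_eq_enorm_sub, proj, proj, ← map_sub]
  rfl

theorem measure_le_map_proj_image (μ : Measure (Euc n)) (V : Grassmann n m) (F : Set (Euc n)) :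
    μ F ≤ μ.map V.proj (V.proj '' F) :=
  (measure_mono (subset_preimage_image _ _)).trans
    (le_map_apply V.1.orthogonalProjectionOnto.continuous.measurable.aemeasurable _)

/-- If the projected measure has growth exponent `t` at almost every point, then every set of positive
outer measure has projection of dimension at least `t`. The hypothesis does not involve the set, and
this is what makes the exceptional set of `V` uniform. -/
theorem ofReal_le_dimH_image_proj (μ : Measure (Euc n)) (V : Grassmann n m) {t : ℝ} (ht : 0 < t)
    (h : ∀ᵐ x ∂μ, ∑' j, (2 ^ t) ^ j * tubeMass μ j V x < ∞) {F : Set (Euc n)} (hF : μ F ≠ 0) :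
    ENNReal.ofReal t ≤ dimH (V.proj '' F) := by
  obtain ⟨k, hk⟩ := exists_nat_measure_inter_setOf_lt_ne_zero h hF
  refine le_trans ?_ (dimH_mono (image_mono (inter_subset_left (t :=
    {x | ∑' j, (2 ^ t) ^ j * tubeMass μ j V x < k}))))
  lift t to ℝ≥0 using ht.le
  rw [ENNReal.ofReal_coe_nnreal]
  refine le_dimH_of_hausdorffMeasure_ne_zero (hausdorffMeasure_ne_zero_of_measure_closedEBall_le
    (μ.map V.proj) ht (K := k) (by simp)
    (ne_of_gt (hk.bot_lt.trans_le (measure_le_map_proj_image μ V _))) ?_)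
  rintro _ ⟨x, ⟨-, hx⟩, rfl⟩ j
  rw [← tubeMass_eq_map_proj, ENNReal.inv_rpow, ← ENNReal.inv_pow, ← div_eq_mul_inv,
    ENNReal.le_div_iff_mul_le (Or.inl (by simp [ENNReal.rpow_eq_zero_iff]))
    (Or.inl (ENNReal.pow_ne_top (ENNReal.rpow_ne_top_of_nonneg t.coe_nonneg (by simp)))), mul_comm]
  exact (ENNReal.le_tsum j).trans hx.le

/-- If the projected measure has finite lower `m`-density at almost every point, then every set of
positive outer measure has projection of positive Lebesgue measure. -/
theorem lebesgue_image_proj_ne_zero (μ : Measure (Euc n)) [IsFiniteMeasure μ] (V : Grassmann n m)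
    (h : ∀ᵐ x ∂μ, liminf (fun j => (2 ^ m) ^ j * tubeMass μ j V x) atTop < ∞)
    {F : Set (Euc n)} (hF : μ F ≠ 0) : V.lebesgue (V.proj '' F) ≠ 0 := by
  obtain ⟨k, hk⟩ := exists_nat_measure_inter_setOf_lt_ne_zero h hF
  intro h0
  refine ne_of_gt (hk.bot_lt.trans_le (measure_le_map_proj_image μ V _)) ?_
  refine measure_eq_zero_of_frequently_measure_closedBall_le (volume : Measure V.1) _
    (K := k) (by simp) ?_ (measure_mono_null (image_mono inter_subset_left) h0)
  rintro _ ⟨x, ⟨-, hx⟩, rfl⟩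
  refine (frequently_lt_of_liminf_lt (u := fun j => (2 ^ m) ^ j * tubeMass μ j V x)
    (by isBoundedDefault) hx).mono fun j hj => ?_
  rw [← tubeMass_eq_map_proj, V.2, ← ENNReal.inv_pow, ← ENNReal.inv_pow, ← div_eq_mul_inv,
    ENNReal.le_div_iff_mul_le (Or.inl (by simp)) (Or.inl (by finiteness)), mul_comm]
  exact hj.le

theorem dimH_image_proj_le (V : Grassmann n m) (F : Set (Euc n)) :
    dimH (V.proj '' F) ≤ min (dimH F) m := by
  refine le_min (V.1.orthogonalProjectionOnto.lipschitz.dimH_image_le F) ?_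
  refine (dimH_mono (subset_univ _)).trans (le_of_eq ?_)
  rw [Real.dimH_univ_eq_finrank, V.2]

end Grassmann

/-! ### Projections of sets of positive Hausdorff measure -/

/-- Where it is finite, the measure `ℋˢ` has finite `t`-potential for all `t < s`, at almost every
point. -/
theorem ae_lintegral_edist_rpow_neg_lt_top {n : ℕ} {s : ℝ} (hs : 0 < s) {A : Set (Euc n)}
    (hA : μH[s] A ≠ ∞) :
    ∀ᵐ x ∂(μH[s] : Measure (Euc n)).restrict A, ∀ t : ℝ, 0 < t → t < s →
      ∫⁻ y, edist y x ^ (-t) ∂(μH[s] : Measure (Euc n)).restrict A < ∞ := by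
  set μ := (μH[s] : Measure (Euc n)).restrict A
  have : IsFiniteMeasure μ := ⟨by simpa [μ] using hA.lt_top⟩
  have h0 := hausdorffMeasure_setOf_forall_exists_lt_measure_closedEBall hs μ
  filter_upwards [restrict_le_self.absolutelyContinuous.ae_le
    (measure_eq_zero_iff_ae_notMem.1 h0)] with x hx t ht hts
  have hx' : ∃ k : ℕ, ∀ r : ℝ≥0, 0 < r → μ (closedEBall x r) ≤ k * (r : ℝ≥0∞) ^ s := by
    simpa using hx
  obtain ⟨k, hk⟩ := hx'
  exact lintegral_edist_rpow_neg_lt_top μ ht hts (by simp) hk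

theorem theorem2p1 (n m : ℕ) (hm : 1 ≤ m) (hmn : m < n) (s : ℝ) (hs : 0 < s) (E : Set (Euc n))
    (hE : HausdorffMeasurable s E) (hdim : dimH E = ENNReal.ofReal s)
    (hpos : 0 < μH[s] E) (hfin : μH[s] E < ⊤) :
    ∃ X : Set (Grassmann n m), Grassmann.γ n m hmn.le X = 0 ∧
      ∀ V : Grassmann n m, V ∉ X → ∀ F : Set (Euc n), F ⊆ E → HausdorffMeasurable s F →
        0 < μH[s] F →
          dimH (V.proj '' F) = min (dimH F) (m : ENNReal) ∧
          ((m : ℝ) < s → 0 < V.lebesgue (V.proj '' F)) := by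
  set μ := (μH[s] : Measure (Euc n)).restrict E with hμ
  have : IsFiniteMeasure μ := ⟨by simpa [μ] using hfin⟩
  have hm0 : (0 : ℝ) < m := by exact_mod_cast hm
  have hpot := ae_lintegral_edist_rpow_neg_lt_top hs hfin.ne
  rw [← hμ] at hpot
  have hsmall : ∀ᵐ V ∂(Grassmann.γ n m hmn.le), ∀ q : ℚ, 0 < q → (q : ℝ) < min s m →
      ∀ᵐ x ∂μ, ∑' j, (2 ^ (q : ℝ)) ^ j * Grassmann.tubeMass μ j V x < ∞ := by
    refine ae_all_iff.2 fun q => ?_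
    by_cases hq : 0 < q ∧ (q : ℝ) < min s m
    -- A slightly larger exponent `t` makes the sum over the dyadic scales converge.
    · obtain ⟨t, hqt, htm⟩ := exists_between hq.2
      have ht : 0 < t := (Rat.cast_pos.2 hq.1).trans hqt
      have := (ae_ae_comm (μ := Grassmann.γ n m hmn.le) (ν := μ)
        (p := fun V x => ∑' j, (2 ^ (q : ℝ)) ^ j * Grassmann.tubeMass μ j V x < ∞)
        (measurableSet_lt (Measurable.tsum fun j =>
          (Grassmann.measurable_tubeMass μ j).const_mul _) measurable_const)).2
        (hpot.mono fun x hx => Grassmann.ae_tsum_tubeMass_lt_top hm hmn.le μ hqt ht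
          (htm.le.trans (min_le_right _ _)) (hx t ht (htm.trans_le (min_le_left _ _))))
      filter_upwards [this] with V hV _ _ using hV
    · exact Eventually.of_forall fun V h1 h2 => absurd ⟨h1, h2⟩ hq
  have hlarge : ∀ᵐ V ∂(Grassmann.γ n m hmn.le), (m : ℝ) < s →
      ∀ᵐ x ∂μ, liminf (fun j => (2 ^ m) ^ j * Grassmann.tubeMass μ j V x) atTop < ∞ := by
    by_cases hms : (m : ℝ) < s
    · have := (ae_ae_comm (μ := Grassmann.γ n m hmn.le) (ν := μ)
        (p := fun V x => liminf (fun j => (2 ^ m) ^ j * Grassmann.tubeMass μ j V x) atTop < ∞)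
        (measurableSet_lt (Measurable.liminf fun j =>
          (Grassmann.measurable_tubeMass μ j).const_mul _) measurable_const)).2
        (hpot.mono fun x hx => Grassmann.ae_liminf_tubeMass_lt_top hm hmn.le μ (hx m hm0 hms))
      filter_upwards [this] with V hV _ using hV
    · exact Eventually.of_forall fun V h => absurd h hms
  -- The exceptional set is the complement of the set of `V` with both properties, neither of which
  -- mentions `F`.
  refine ⟨_, hsmall.and hlarge, fun V hV F hFE _ hF => ?_⟩
  obtain ⟨hV1, hV2⟩ := not_not.1 hV
  have hμF : μ F = μH[s] F := restrict_eq_self _ hFE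
  have hμF0 : μ F ≠ 0 := hμF ▸ hF.ne'
  have hdimF : dimH F = ENNReal.ofReal s :=
    dimH_of_hausdorffMeasure_ne_zero_ne_top (d := s.toNNReal)
      (by rw [Real.coe_toNNReal _ hs.le]; exact hF.ne')
      (by rw [Real.coe_toNNReal _ hs.le]; exact ((measure_mono hFE).trans_lt hfin).ne)
  refine ⟨le_antisymm (V.dimH_image_proj_le F) ?_, fun hms =>
    (Grassmann.lebesgue_image_proj_ne_zero μ V (hV2 hms) hμF0).bot_lt⟩
  rw [hdimF, ← ENNReal.ofReal_natCast, ← ENNReal.ofReal_min]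
  refine le_of_forall_lt fun c hc => ?_
  obtain ⟨q, hq0, hcq, hq⟩ := ENNReal.lt_iff_exists_rat_btwn.1 hc
  have hq' : (q : ℝ) < min s m := ((ENNReal.ofReal_lt_ofReal_iff (lt_min hs hm0)).1 hq)
  have hqpos : 0 < q := by
    refine lt_of_le_of_ne hq0 ?_
    rintro rfl
    simp at hcq
  exact hcq.trans_le (Grassmann.ofReal_le_dimH_image_proj μ V (Rat.cast_pos.2 hqpos)
    (hV1 q hqpos hq') hμF0)
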